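/- Let $\nu\ge 1$ be an integer and let $\mathbf T^\nu=(\mathbf R/2\pi\mathbf Z)^\nu$ carry Lebesgue measure (of total mass $(2\pi)^\nu$). Let $\mathcal H_n=L_2((\mathbf T^\nu)^n)$, $n=1,2,3$, be the Hilbert spaces of complex square-integrable functions. Let $v_2,v_3,v_{21},v_{22},w_1$ be real-valued continuous functions on $\mathbf T^\nu$, and let $w_2$ and $w_3$ be real-valued continuous functions on $(\mathbf T^\nu)^2$ and $(\mathbf T^\nu)^3$, respectively. Define bounded operators by $$(H_{11}f_1)(p)=w_1(p)f_1(p),\quad (H_{12}f_2)(p)=\int_{\mathbf T^\nu}v_2(s)f_2(p,s)\,ds,\quad (H_{21}f_1)(p,q)=v_2(q)f_1(p),$$ $$(H_{22}^0f_2)(p,q)=w_2(p,q)f_2(p,q),\quad (V_{21}f_2)(p,q)=v_{21}(p)\int_{\mathbf T^\nu}v_{21}(s)f_2(s,q)\,ds,$$ $$(V_{22}f_2)(p,q)=v_{22}(q)\int_{\mathbf T^\nu}v_{22}(s)f_2(p,s)\,ds,\quad (H_{23}f_3)(p,q)=\int_{\mathbf T^\nu}v_3(s)f_3(p,q,s)\,ds,$$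 $$(H_{32}f_2)(p,q,t)=v_3(t)f_2(p,q),\quad (H_{33}f_3)(p,q,t)=w_3(p,q,t)f_3(p,q,t),$$ where $f_i\in\mathcal H_i$, and define the channel operators $H_1,H_3$ on $\mathcal H_2\oplus\mathcal H_3$ and $H_2$ on $\mathcal H_1\oplus\mathcal H_2\oplus\mathcal H_3$ by $$H_1=\begin{pmatrix}H_{22}^0-V_{21}&H_{23}\\H_{32}&H_{33}\end{pmatrix},\quad H_2=\begin{pmatrix}H_{11}&H_{12}&0\\H_{21}&H_{22}^0-V_{22}&H_{23}\\0&H_{32}&H_{33}\end{pmatrix},\quad H_3=\begin{pmatrix}H_{22}^0&H_{23}\\H_{32}&H_{33}\end{pmatrix}.$$ Then the spectra of these operators satisfy $$\sigma(H_3)\subset\sigma(H_1)\cup\sigma(H_2).$$ -/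

import Mathlib

open MeasureTheory
open scoped ENNReal

set_option linter.unusedSectionVars false

noncomputable section

namespace FockModel

instance factTwoPiPos : Fact (0 < 2 * Real.pi) := ⟨Real.two_pi_pos⟩

/-- The torus `(ℝ / 2πℤ)^ν`.  Its `volume` is Lebesgue measure, of total mass `(2π)^ν`. -/
abbrev Torus (ν : ℕ) : Type := Fin ν → AddCircle (2 * Real.pi)

/-- The square `𝕋^ν × 𝕋^ν`, points `(p, q)`. -/
abbrev Torus2 (ν : ℕ) : Type := Torus ν × Torus ν

/-- The cube `𝕋^ν × 𝕋^ν × 𝕋^ν`, points `((p, q), t)`. -/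
abbrev Torus3 (ν : ℕ) : Type := Torus2 ν × Torus ν

instance opensMeasurableSpaceTorus2 (ν : ℕ) : OpensMeasurableSpace (Torus2 ν) :=
  Prod.opensMeasurableSpace

instance opensMeasurableSpaceTorus3 (ν : ℕ) : OpensMeasurableSpace (Torus3 ν) :=
  Prod.opensMeasurableSpace

/-- The Hilbert space of complex square-integrable functions on `X`. -/
abbrev L2 (X : Type) [MeasureSpace X] : Type := Lp ℂ 2 (volume : Measure X)

/-! ### Multiplication operators -/

section Multiplication

variable {X : Type} [MeasureSpace X] [TopologicalSpace X] [CompactSpace X]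
  [OpensMeasurableSpace X]

theorem ae_norm_mul_le (w : C(X, ℝ)) (f : X → ℂ) :
    ∀ᵐ x ∂(volume : Measure X), ‖(w x : ℂ) * f x‖ ≤ ‖w‖ * ‖f x‖ := by
  refine Filter.Eventually.of_forall fun x => ?_
  rw [norm_mul, Complex.norm_real]
  exact mul_le_mul_of_nonneg_right (w.norm_coe_le_norm x) (norm_nonneg _)

theorem memLp_mul (w : C(X, ℝ)) {f : X → ℂ} (hf : MemLp f 2 (volume : Measure X)) :
    MemLp (fun x => (w x : ℂ) * f x) 2 (volume : Measure X) :=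
  hf.of_le_mul ((Complex.continuous_ofReal.comp w.continuous).aestronglyMeasurable.mul
    hf.aestronglyMeasurable) (ae_norm_mul_le w f)

/-- Multiplication by the continuous real function `w`: `(W f)(x) = w(x) f(x)`. -/
def mulOp (w : C(X, ℝ)) : L2 X →L[ℂ] L2 X :=
  LinearMap.mkContinuous
    { toFun := fun f => (memLp_mul w (Lp.memLp f)).toLp (fun x => (w x : ℂ) * f x)
      map_add' := fun f g => by
        rw [← MemLp.toLp_add]
        refine MemLp.toLp_congr _ _ ?_
        filter_upwards [Lp.coeFn_add f g] with x hx
        rw [hx, Pi.add_apply, Pi.add_apply, mul_add]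
      map_smul' := fun c f => by
        rw [RingHom.id_apply, ← MemLp.toLp_const_smul]
        refine MemLp.toLp_congr _ _ ?_
        filter_upwards [Lp.coeFn_smul c f] with x hx
        simp [hx, mul_left_comm] }
    ‖w‖ (fun f => by
      refine Lp.norm_le_mul_norm_of_ae_le_mul ?_
      filter_upwards [(memLp_mul w (Lp.memLp f)).coeFn_toLp, ae_norm_mul_le w f] with x hx h
      simpa [hx] using h)

end Multiplication

section Integral

variable {X : Type} [MeasureSpace X] [IsFiniteMeasure (volume : Measure X)]
  {Y : Type} [MeasureSpace Y] [TopologicalSpace Y] [CompactSpace Y] [OpensMeasurableSpace Y]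
  [IsFiniteMeasure (volume : Measure Y)]

/-! ### Creation operators -/

theorem memLp_create (v : C(Y, ℝ)) {f : X → ℂ} (hf : MemLp f 2 (volume : Measure X)) :
    MemLp (fun z : X × Y => (v z.2 : ℂ) * f z.1) 2 (volume : Measure (X × Y)) := by
  have h1 : MemLp (fun z : X × Y => f z.1) 2 (volume : Measure (X × Y)) :=
    hf.comp_fst (volume : Measure Y)
  refine h1.of_le_mul (c := ‖v‖) ?_ (Filter.Eventually.of_forall fun z => ?_)
  · have h2 : AEStronglyMeasurable (fun y : Y => (v y : ℂ)) (volume : Measure Y) :=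
      (Complex.continuous_ofReal.comp v.continuous).aestronglyMeasurable
    have h3 : AEStronglyMeasurable (fun z : X × Y => (v z.2 : ℂ)) (volume : Measure (X × Y)) :=
      h2.comp_snd (μ := (volume : Measure X))
    exact h3.mul h1.aestronglyMeasurable
  · rw [norm_mul, Complex.norm_real]
    exact mul_le_mul_of_nonneg_right (v.norm_coe_le_norm z.2) (norm_nonneg _)

theorem ae_fst {P : X → Prop} (h : ∀ᵐ x ∂(volume : Measure X), P x) :
    ∀ᵐ z ∂(volume : Measure (X × Y)), P z.1 :=
  (Measure.quasiMeasurePreserving_fst (μ := (volume : Measure X))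
    (ν := (volume : Measure Y))).ae h

theorem eLpNorm_create_le (v : C(Y, ℝ)) {f : X → ℂ} (hf : MemLp f 2 (volume : Measure X)) :
    eLpNorm (fun z : X × Y => (v z.2 : ℂ) * f z.1) 2 (volume : Measure (X × Y)) ≤
      eLpNorm (fun y => (v y : ℂ)) 2 (volume : Measure Y) * eLpNorm f 2 (volume : Measure X) := by
  have hv : AEStronglyMeasurable (fun y : Y => (v y : ℂ)) (volume : Measure Y) :=
    (Complex.continuous_ofReal.comp v.continuous).aestronglyMeasurable
  rw [eLpNorm_eq_lintegral_rpow_enorm_toReal two_ne_zero ENNReal.ofNat_ne_top,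
    eLpNorm_eq_lintegral_rpow_enorm_toReal two_ne_zero ENNReal.ofNat_ne_top,
    eLpNorm_eq_lintegral_rpow_enorm_toReal two_ne_zero ENNReal.ofNat_ne_top,
    ← ENNReal.mul_rpow_of_nonneg _ _ (by positivity)]
  refine ENNReal.rpow_le_rpow (le_of_eq ?_) (by positivity)
  rw [mul_comm, Measure.volume_eq_prod,
    ← lintegral_prod_mul (hf.aestronglyMeasurable.enorm.pow_const _) (hv.enorm.pow_const _)]
  refine lintegral_congr fun z => ?_
  rw [enorm_mul, ENNReal.mul_rpow_of_nonneg _ _ (by positivity), mul_comm]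

theorem memLp_coe (v : C(Y, ℝ)) : MemLp (fun y => (v y : ℂ)) 2 (volume : Measure Y) :=
  MemLp.of_bound (Complex.continuous_ofReal.comp v.continuous).aestronglyMeasurable ‖v‖
    (Filter.Eventually.of_forall fun y => by
      rw [Complex.norm_real]; exact v.norm_coe_le_norm y)

/-- The creation operator `(C f)(x, y) = v(y) f(x)`. -/
def createOp (X : Type) [MeasureSpace X] [IsFiniteMeasure (volume : Measure X)] (v : C(Y, ℝ)) :
    L2 X →L[ℂ] L2 (X × Y) :=
  LinearMap.mkContinuous
    { toFun := fun f =>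
        (memLp_create v (Lp.memLp f)).toLp (fun z : X × Y => (v z.2 : ℂ) * f z.1)
      map_add' := fun f g => by
        rw [← MemLp.toLp_add]
        refine MemLp.toLp_congr _ _ ?_
        filter_upwards [ae_fst (Lp.coeFn_add f g)] with x hx
        rw [hx, Pi.add_apply, Pi.add_apply, mul_add]
      map_smul' := fun c f => by
        rw [RingHom.id_apply, ← MemLp.toLp_const_smul]
        refine MemLp.toLp_congr _ _ ?_
        filter_upwards [ae_fst (Lp.coeFn_smul c f)] with x hx
        simp [hx, mul_left_comm] }
    (eLpNorm (fun y => (v y : ℂ)) 2 (volume : Measure Y)).toReal (fun f => by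
      change ‖(memLp_create v (Lp.memLp f)).toLp _‖ ≤ _
      rw [Lp.norm_toLp, Lp.norm_def, ← ENNReal.toReal_mul]
      exact ENNReal.toReal_mono
        (ENNReal.mul_ne_top (memLp_coe v).eLpNorm_ne_top (Lp.memLp f).eLpNorm_ne_top)
        (eLpNorm_create_le v (Lp.memLp f)))

/-! ### Annihilation operators -/

theorem eLpNorm_annihilate_le (v : C(Y, ℝ)) {f : X × Y → ℂ}
    (hf : MemLp f 2 (volume : Measure (X × Y))) :
    eLpNorm (fun x => ∫ s, (v s : ℂ) * f (x, s)) 2 (volume : Measure X) ≤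
      eLpNorm (fun y => (v y : ℂ)) 2 (volume : Measure Y) *
        eLpNorm f 2 (volume : Measure (X × Y)) := by
  have hv : AEStronglyMeasurable (fun y : Y => (v y : ℂ)) (volume : Measure Y) :=
    (Complex.continuous_ofReal.comp v.continuous).aestronglyMeasurable
  have hfm : AEStronglyMeasurable f ((volume : Measure X).prod (volume : Measure Y)) :=
    hf.aestronglyMeasurable
  rw [eLpNorm_eq_lintegral_rpow_enorm_toReal two_ne_zero ENNReal.ofNat_ne_top,
    eLpNorm_eq_lintegral_rpow_enorm_toReal two_ne_zero ENNReal.ofNat_ne_top,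
    eLpNorm_eq_lintegral_rpow_enorm_toReal two_ne_zero ENNReal.ofNat_ne_top,
    ← ENNReal.mul_rpow_of_nonneg _ _ (by positivity)]
  refine ENNReal.rpow_le_rpow ?_ (by positivity)
  have hm : AEMeasurable (fun z => ‖f z‖ₑ ^ (2 : ℝ≥0∞).toReal)
      ((volume : Measure X).prod (volume : Measure Y)) := hfm.enorm.pow_const _
  rw [Measure.volume_eq_prod, lintegral_prod _ hm,
    ← lintegral_const_mul'' _ hm.lintegral_prod_right']
  refine lintegral_mono_ae ?_
  filter_upwards [hfm.prodMk_left] with x hx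
  have hH := ENNReal.lintegral_mul_le_Lp_mul_Lq (volume : Measure Y)
    (Real.HolderConjugate.two_two) hv.enorm hx.enorm
  have h1 : ‖∫ s, (v s : ℂ) * f (x, s)‖ₑ ≤
      (∫⁻ y, ‖(v y : ℂ)‖ₑ ^ (2 : ℝ)) ^ (1 / (2 : ℝ)) *
        (∫⁻ y, ‖f (x, y)‖ₑ ^ (2 : ℝ)) ^ (1 / (2 : ℝ)) := by
    refine (enorm_integral_le_lintegral_enorm _).trans (le_trans (le_of_eq ?_) hH)
    exact lintegral_congr fun s => by simp [enorm_mul]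
  rw [← ENNReal.mul_rpow_of_nonneg _ _ (by positivity)] at h1
  have h2 := ENNReal.rpow_le_rpow h1 (z := 2) (by norm_num)
  rw [← ENNReal.rpow_mul] at h2
  simpa using h2

theorem memLp_annihilate (v : C(Y, ℝ)) {f : X × Y → ℂ}
    (hf : MemLp f 2 (volume : Measure (X × Y))) :
    MemLp (fun x => ∫ s, (v s : ℂ) * f (x, s)) 2 (volume : Measure X) := by
  refine ⟨?_, (eLpNorm_annihilate_le v hf).trans_lt
    (ENNReal.mul_lt_top (memLp_coe v).eLpNorm_lt_top hf.eLpNorm_lt_top)⟩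
  have h2 : AEStronglyMeasurable (fun y : Y => (v y : ℂ)) (volume : Measure Y) :=
    (Complex.continuous_ofReal.comp v.continuous).aestronglyMeasurable
  have h3 : AEStronglyMeasurable (fun z : X × Y => (v z.2 : ℂ) * f z)
      ((volume : Measure X).prod (volume : Measure Y)) :=
    (h2.comp_snd (μ := (volume : Measure X))).mul hf.aestronglyMeasurable
  exact h3.integral_prod_right'

theorem ae_ae_slice {P : X × Y → Prop} (h : ∀ᵐ z ∂(volume : Measure (X × Y)), P z) :
    ∀ᵐ x ∂(volume : Measure X), ∀ᵐ s ∂(volume : Measure Y), P (x, s) :=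
  Measure.ae_ae_of_ae_prod h

theorem ae_integrable_slice (v : C(Y, ℝ)) {f : X × Y → ℂ}
    (hf : MemLp f 2 (volume : Measure (X × Y))) :
    ∀ᵐ x ∂(volume : Measure X), Integrable (fun s => (v s : ℂ) * f (x, s)) := by
  have h : Integrable f ((volume : Measure X).prod (volume : Measure Y)) :=
    hf.integrable (by norm_num)
  filter_upwards [h.prod_right_ae] with x hx
  exact hx.bdd_mul (Complex.continuous_ofReal.comp v.continuous).aestronglyMeasurable
    (c := ‖v‖) (Filter.Eventually.of_forall fun s => by
      rw [Complex.norm_real]; exact v.norm_coe_le_norm s)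

/-- The annihilation operator `(A f)(x) = ∫ v(s) f(x, s) ds`. -/
def annihilateOp (X : Type) [MeasureSpace X] [IsFiniteMeasure (volume : Measure X)] (v : C(Y, ℝ)) :
    L2 (X × Y) →L[ℂ] L2 X :=
  LinearMap.mkContinuous
    { toFun := fun f =>
        (memLp_annihilate v (Lp.memLp f)).toLp (fun x => ∫ s, (v s : ℂ) * f (x, s))
      map_add' := fun f g => by
        rw [← MemLp.toLp_add]
        refine MemLp.toLp_congr _ _ ?_
        filter_upwards [ae_ae_slice (Lp.coeFn_add f g), ae_integrable_slice v (Lp.memLp f),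
          ae_integrable_slice v (Lp.memLp g)] with x hx h1 h2
        rw [Pi.add_apply, ← integral_add h1 h2]
        refine integral_congr_ae ?_
        filter_upwards [hx] with s hs
        rw [hs, Pi.add_apply, mul_add]
      map_smul' := fun c f => by
        rw [RingHom.id_apply, ← MemLp.toLp_const_smul]
        refine MemLp.toLp_congr _ _ ?_
        filter_upwards [ae_ae_slice (Lp.coeFn_smul c f)] with x hx
        rw [Pi.smul_apply, ← integral_smul]
        refine integral_congr_ae ?_
        filter_upwards [hx] with s hs
        simp [hs, mul_left_comm] }
    (eLpNorm (fun y => (v y : ℂ)) 2 (volume : Measure Y)).toReal (fun f => by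
      change ‖(memLp_annihilate v (Lp.memLp f)).toLp _‖ ≤ _
      rw [Lp.norm_toLp, Lp.norm_def, ← ENNReal.toReal_mul]
      exact ENNReal.toReal_mono
        (ENNReal.mul_ne_top (memLp_coe v).eLpNorm_ne_top (Lp.memLp f).eLpNorm_ne_top)
        (eLpNorm_annihilate_le v (Lp.memLp f)))

/-! ### Partial integral operators -/

/-- `(V f)(p, q) = v(q) ∫ v(s) f(p, s) ds`. -/
def partialOpSnd (v : C(Y, ℝ)) : L2 (Y × Y) →L[ℂ] L2 (Y × Y) :=
  createOp Y v ∘L annihilateOp Y v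

/-- The exchange of variables `(S f)(p, q) = f(q, p)`. -/
def swapOp (Y : Type) [MeasureSpace Y] [IsFiniteMeasure (volume : Measure Y)] :
    L2 (Y × Y) →L[ℂ] L2 (Y × Y) :=
  (Lp.compMeasurePreservingₗᵢ ℂ (Prod.swap : Y × Y → Y × Y)
    (Measure.measurePreserving_swap (μ := (volume : Measure Y))
      (ν := (volume : Measure Y)))).toContinuousLinearMap

/-- `(V f)(p, q) = v(p) ∫ v(s) f(s, q) ds`, the operator `partialOpSnd v` with the roles of the
two variables exchanged. -/
def partialOpFst (v : C(Y, ℝ)) : L2 (Y × Y) →L[ℂ] L2 (Y × Y) :=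
  swapOp Y ∘L partialOpSnd v ∘L swapOp Y

end Integral

/-! ### Operator matrices on Hilbert direct sums -/

section Blocks

variable {E F G : Type}
  [NormedAddCommGroup E] [NormedSpace ℂ E] [NormedAddCommGroup F] [NormedSpace ℂ F]
  [NormedAddCommGroup G] [NormedSpace ℂ G]

/-- The operator `(x, y) ↦ (A x + B y, C x + D y)` on the Hilbert direct sum of `E` and `F`. -/
def blockOp2 (A : E →L[ℂ] E) (B : F →L[ℂ] E) (C : E →L[ℂ] F) (D : F →L[ℂ] F) :
    WithLp 2 (E × F) →L[ℂ] WithLp 2 (E × F) :=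
  ((WithLp.prodContinuousLinearEquiv 2 ℂ E F).symm : E × F →L[ℂ] WithLp 2 (E × F)) ∘L
    ((A.coprod B).prod (C.coprod D)) ∘L
      ((WithLp.prodContinuousLinearEquiv 2 ℂ E F) : WithLp 2 (E × F) →L[ℂ] E × F)

/-- The operator on the Hilbert direct sum of `E`, `F` and `G` with the given `3 × 3` matrix. -/
def blockOp3 (A₁₁ : E →L[ℂ] E) (A₁₂ : F →L[ℂ] E) (A₁₃ : G →L[ℂ] E)
    (A₂₁ : E →L[ℂ] F) (A₂₂ : F →L[ℂ] F) (A₂₃ : G →L[ℂ] F)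
    (A₃₁ : E →L[ℂ] G) (A₃₂ : F →L[ℂ] G) (A₃₃ : G →L[ℂ] G) :
    WithLp 2 (E × WithLp 2 (F × G)) →L[ℂ] WithLp 2 (E × WithLp 2 (F × G)) :=
  blockOp2 A₁₁
    (A₁₂.coprod A₁₃ ∘L
      ((WithLp.prodContinuousLinearEquiv 2 ℂ F G) : WithLp 2 (F × G) →L[ℂ] F × G))
    (((WithLp.prodContinuousLinearEquiv 2 ℂ F G).symm : F × G →L[ℂ] WithLp 2 (F × G)) ∘L
      A₂₁.prod A₃₁)
    (blockOp2 A₂₂ A₂₃ A₃₂ A₃₃)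

end Blocks

/-! ### The channel operators -/

section Channels

variable {ν : ℕ}

/-- `L₂((𝕋^ν)²) ⊕ L₂((𝕋^ν)³)`. -/
abbrev H23 (ν : ℕ) : Type := WithLp 2 (L2 (Torus2 ν) × L2 (Torus3 ν))

/-- `L₂(𝕋^ν) ⊕ L₂((𝕋^ν)²) ⊕ L₂((𝕋^ν)³)`. -/
abbrev H13 (ν : ℕ) : Type := WithLp 2 (L2 (Torus ν) × H23 ν)

/-- The channel operator `H₁`. -/
def channelH1 (w₂ : C(Torus2 ν, ℝ)) (w₃ : C(Torus3 ν, ℝ)) (v₂₁ v₃ : C(Torus ν, ℝ)) :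
    H23 ν →L[ℂ] H23 ν :=
  blockOp2
    (mulOp w₂ - partialOpFst v₂₁) (annihilateOp (Torus2 ν) v₃)
    (createOp (Torus2 ν) v₃)      (mulOp w₃)

/-- The channel operator `H₂`. -/
def channelH2 (w₁ : C(Torus ν, ℝ)) (w₂ : C(Torus2 ν, ℝ)) (w₃ : C(Torus3 ν, ℝ))
    (v₂ v₂₂ v₃ : C(Torus ν, ℝ)) : H13 ν →L[ℂ] H13 ν :=
  blockOp3
    (mulOp w₁)             (annihilateOp (Torus ν) v₂)   0
    (createOp (Torus ν) v₂) (mulOp w₂ - partialOpSnd v₂₂) (annihilateOp (Torus2 ν) v₃)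
    0                      (createOp (Torus2 ν) v₃)      (mulOp w₃)

/-- The channel operator `H₃`. -/
def channelH3 (w₂ : C(Torus2 ν, ℝ)) (w₃ : C(Torus3 ν, ℝ)) (v₃ : C(Torus ν, ℝ)) :
    H23 ν →L[ℂ] H23 ν :=
  blockOp2
    (mulOp w₂)               (annihilateOp (Torus2 ν) v₃)
    (createOp (Torus2 ν) v₃) (mulOp w₃)

end Channels

end FockModel

end

open scoped InnerProductSpace NNReal
open Filter Topology

noncomputable section

namespace FockModel

/-! ### Invertibility of normal operators -/

/-! Already `σ(H₃) ⊆ σ(H₁)`. The operators differ only by `V₂₁`, which integrates over `p`, whereas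
`p` is a mere parameter in `H₃`. Let `Uₙ` multiply both components by `exp (i n p₁)`. These
isometries commute with `H₃`, and `V₂₁ Uₙ → 0` strongly by Riemann–Lebesgue
(`tendsto_partialOpFst_modOp`). If `z - H₁` is invertible, its lower bound at `Uₙ f` gives `‖f‖ ≤ c
‖(z - H₃) f‖ + c ‖V₂₁ Uₙ f‖`. As `n → ∞`, `z - H₃` is bounded below; being normal, it is invertible
(`spectrum_subset_of_asymptotically_invisible`). -/

/-- For a normal operator the orthogonal complement of the range is the kernel, so injectivity
already forces dense range; the lower bound supplies the rest. -/
theorem isUnit_of_isStarNormal_of_antilipschitz {E : Type*} [NormedAddCommGroup E]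
    [InnerProductSpace ℂ E] [CompleteSpace E] {T : E →L[ℂ] E} (hT : IsStarNormal T) {c : ℝ≥0}
    (h : AntilipschitzWith c T) : IsUnit T := by
  rw [ContinuousLinearMap.isUnit_iff_bijective,
    ContinuousLinearMap.bijective_iff_dense_range_and_antilipschitz]
  refine ⟨?_, c, h⟩
  rw [Submodule.topologicalClosure_eq_top_iff,
    ContinuousLinearMap.IsStarNormal.orthogonal_range hT]
  exact LinearMap.ker_eq_bot.mpr h.injective

/-- Normality is the right notion because `z` may be non-real; the adjoint is again a scalar minus
`a`. -/
theorem isStarNormal_algebraMap_sub {A : Type*} [Ring A] [StarRing A] [Algebra ℂ A]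
    [StarModule ℂ A] {a : A} (ha : IsSelfAdjoint a) (z : ℂ) :
    IsStarNormal (algebraMap ℂ A z - a) := by
  refine ⟨?_⟩
  rw [star_sub, ha.star_eq, ← algebraMap_star_comm]
  exact ((Algebra.commute_algebraMap_right _ _).sub_right
    (Algebra.commute_algebraMap_left _ _)).sub_left
      ((Algebra.commute_algebraMap_right _ _).sub_right (Commute.refl a))

/-- If `A` commutes with isometries `U n` and `K ∘ U n` tends strongly to zero, then the spectrum
of the self-adjoint operator `A` is contained in the spectrum of `A - K`. -/
theorem spectrum_subset_of_asymptotically_invisible {E : Type*} [NormedAddCommGroup E]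
    [InnerProductSpace ℂ E] [CompleteSpace E] {A B : E →L[ℂ] E} (hA : IsSelfAdjoint A)
    (U : ℕ → E →ₗᵢ[ℂ] E) (hU : ∀ n f, A (U n f) = U n (A f))
    (hB : ∀ f, Tendsto (fun n => (A - B) (U n f)) atTop (𝓝 0)) :
    spectrum ℂ A ⊆ spectrum ℂ B := by
  intro z
  contrapose!
  simp only [spectrum.notMem_iff]
  intro hz
  obtain ⟨c, hc⟩ := ((ContinuousLinearMap.bijective_iff_dense_range_and_antilipschitz _).1
    (ContinuousLinearMap.isUnit_iff_bijective.1 hz)).2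
  refine isUnit_of_isStarNormal_of_antilipschitz (isStarNormal_algebraMap_sub hA z) (c := c)
    (ContinuousLinearMap.antilipschitz_of_bound _ fun f => ?_)
  -- The left side and the first summand do not depend on `n`, since `U n` is isometric and commutes
  -- with `A`.
  have h1 : ∀ n, ‖f‖ ≤ c * ‖(algebraMap ℂ (E →L[ℂ] E) z - A) f‖ + c * ‖(A - B) (U n f)‖ := by
    intro n
    have h2 := ContinuousLinearMap.bound_of_antilipschitz _ hc (U n f)
    have h3 : (algebraMap ℂ (E →L[ℂ] E) z - B) (U n f) =
        U n ((algebraMap ℂ (E →L[ℂ] E) z - A) f) + (A - B) (U n f) := by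
      simp [Algebra.algebraMap_eq_smul_one, hU]
    rw [h3, LinearIsometry.norm_map] at h2
    rw [← mul_add]
    refine h2.trans (mul_le_mul_of_nonneg_left ((norm_add_le _ _).trans ?_) c.2)
    rw [LinearIsometry.norm_map]
  refine ge_of_tendsto (x := atTop) (f := fun n =>
    c * ‖(algebraMap ℂ (E →L[ℂ] E) z - A) f‖ + c * ‖(A - B) (U n f)‖) ?_ (Eventually.of_forall h1)
  simpa using (((hB f).norm.const_mul (c : ℝ)).const_add
    (c * ‖(algebraMap ℂ (E →L[ℂ] E) z - A) f‖))

/-! ### Pointwise formulas -/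

theorem mulOp_coeFn {X : Type} [MeasureSpace X] [TopologicalSpace X] [CompactSpace X]
    [OpensMeasurableSpace X] (w : C(X, ℝ)) (f : L2 X) :
    mulOp w f =ᵐ[volume] fun x => (w x : ℂ) * f x :=
  (memLp_mul w (Lp.memLp f)).coeFn_toLp

section Integral

variable {X : Type} [MeasureSpace X] [IsFiniteMeasure (volume : Measure X)]
  {Y : Type} [MeasureSpace Y] [TopologicalSpace Y] [CompactSpace Y] [OpensMeasurableSpace Y]
  [IsFiniteMeasure (volume : Measure Y)]

theorem createOp_coeFn (v : C(Y, ℝ)) (f : L2 X) :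
    createOp X v f =ᵐ[volume] fun z : X × Y => (v z.2 : ℂ) * f z.1 :=
  (memLp_create v (Lp.memLp f)).coeFn_toLp

theorem annihilateOp_coeFn (v : C(Y, ℝ)) (f : L2 (X × Y)) :
    annihilateOp X v f =ᵐ[volume] fun x => ∫ s, (v s : ℂ) * f (x, s) :=
  (memLp_annihilate v (Lp.memLp f)).coeFn_toLp

theorem swapOp_coeFn (f : L2 (Y × Y)) : swapOp Y f =ᵐ[volume] fun z => f z.swap :=
  Lp.coeFn_compMeasurePreserving _ _

/-! ### Symmetry -/

theorem inner_mulOp_left {X : Type} [MeasureSpace X] [TopologicalSpace X] [CompactSpace X]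
    [OpensMeasurableSpace X] (w : C(X, ℝ)) (f g : L2 X) :
    ⟪mulOp w f, g⟫_ℂ = ⟪f, mulOp w g⟫_ℂ := by
  rw [L2.inner_def, L2.inner_def]
  refine integral_congr_ae ?_
  filter_upwards [mulOp_coeFn w f, mulOp_coeFn w g] with x h1 h2
  rw [h1, h2]
  simp only [RCLike.inner_apply, map_mul, Complex.conj_ofReal]
  ring

/-- This is Fubini; `v` is real, so conjugation leaves it unchanged. -/
theorem inner_createOp_left (v : C(Y, ℝ)) (f : L2 X) (g : L2 (X × Y)) :
    ⟪createOp X v f, g⟫_ℂ = ⟪f, annihilateOp X v g⟫_ℂ := by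
  have hi : Integrable (fun z => ⟪createOp X v f z, g z⟫_ℂ)
      ((volume : Measure X).prod (volume : Measure Y)) := L2.integrable_inner _ _
  rw [L2.inner_def, L2.inner_def]
  refine (integral_prod _ hi).trans ?_
  refine integral_congr_ae ?_
  filter_upwards [ae_ae_slice (createOp_coeFn v f), annihilateOp_coeFn v g] with x h1 h2
  rw [h2, RCLike.inner_apply, ← integral_mul_const]
  refine integral_congr_ae ?_
  filter_upwards [h1] with s hs
  rw [hs]
  simp only [RCLike.inner_apply, map_mul, Complex.conj_ofReal]
  ring

theorem inner_annihilateOp_left (v : C(Y, ℝ)) (f : L2 (X × Y)) (g : L2 X) :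
    ⟪annihilateOp X v f, g⟫_ℂ = ⟪f, createOp X v g⟫_ℂ := by
  rw [← inner_conj_symm, ← inner_createOp_left, inner_conj_symm]

theorem isSelfAdjoint_blockOp2 {E F : Type} [NormedAddCommGroup E] [InnerProductSpace ℂ E]
    [CompleteSpace E] [NormedAddCommGroup F] [InnerProductSpace ℂ F] [CompleteSpace F]
    {A : E →L[ℂ] E} {B : F →L[ℂ] E} {C : E →L[ℂ] F} {D : F →L[ℂ] F}
    (hA : ∀ x y, ⟪A x, y⟫_ℂ = ⟪x, A y⟫_ℂ) (hB : ∀ x y, ⟪B x, y⟫_ℂ = ⟪x, C y⟫_ℂ)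
    (hD : ∀ x y, ⟪D x, y⟫_ℂ = ⟪x, D y⟫_ℂ) : IsSelfAdjoint (blockOp2 A B C D) := by
  have hC : ∀ x y, ⟪C x, y⟫_ℂ = ⟪x, B y⟫_ℂ := fun x y => by
    rw [← inner_conj_symm, ← hB, inner_conj_symm]
  rw [ContinuousLinearMap.isSelfAdjoint_iff_isSymmetric]
  intro x y
  simp only [WithLp.prod_inner_apply, blockOp2, ContinuousLinearMap.coe_coe,
    ContinuousLinearMap.comp_apply, ContinuousLinearEquiv.coe_coe,
    ContinuousLinearMap.prod_apply, ContinuousLinearMap.coprod_apply]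
  simp [inner_add_left, inner_add_right, hA, hB, hC, hD]
  ring

/-! ### Modulations -/

theorem memLp_unimodular_mul {X : Type} [MeasureSpace X] [TopologicalSpace X]
    [OpensMeasurableSpace X] (φ : C(X, Circle)) (f : L2 X) :
    MemLp (fun x => (φ x : ℂ) * f x) 2 (volume : Measure X) :=
  (Lp.memLp f).of_le_mul (c := 1)
    ((continuous_subtype_val.comp φ.continuous).aestronglyMeasurable.mul
      (Lp.memLp f).aestronglyMeasurable)
    (Filter.Eventually.of_forall fun x => by simp [Circle.norm_coe])

/-- Multiplication by a unimodular continuous function, as an isometry of `L2 X`. -/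
def modOp {X : Type} [MeasureSpace X] [TopologicalSpace X] [OpensMeasurableSpace X]
    (φ : C(X, Circle)) : L2 X →ₗᵢ[ℂ] L2 X :=
  { toFun := fun f => (memLp_unimodular_mul φ f).toLp _
    map_add' := fun f g => by
      rw [← MemLp.toLp_add]
      refine MemLp.toLp_congr _ _ ?_
      filter_upwards [Lp.coeFn_add f g] with x hx
      rw [hx, Pi.add_apply, Pi.add_apply, mul_add]
    map_smul' := fun c f => by
      rw [RingHom.id_apply, ← MemLp.toLp_const_smul]
      refine MemLp.toLp_congr _ _ ?_
      filter_upwards [Lp.coeFn_smul c f] with x hx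
      simp [hx, mul_left_comm]
    norm_map' := fun f => by
      change ‖(memLp_unimodular_mul φ f).toLp _‖ = _
      rw [Lp.norm_toLp, Lp.norm_def]
      congr 1
      exact eLpNorm_congr_norm_ae (Filter.Eventually.of_forall fun x => by simp [Circle.norm_coe]) }

theorem modOp_coeFn {X : Type} [MeasureSpace X] [TopologicalSpace X] [OpensMeasurableSpace X]
    (φ : C(X, Circle)) (f : L2 X) : modOp φ f =ᵐ[volume] fun x => (φ x : ℂ) * f x :=
  (memLp_unimodular_mul φ f).coeFn_toLp

theorem mulOp_modOp {X : Type} [MeasureSpace X] [TopologicalSpace X] [CompactSpace X]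
    [OpensMeasurableSpace X] (w : C(X, ℝ)) (φ : C(X, Circle)) (f : L2 X) :
    mulOp w (modOp φ f) = modOp φ (mulOp w f) := by
  refine Lp.ext ?_
  filter_upwards [mulOp_coeFn w (modOp φ f), modOp_coeFn φ (mulOp w f), mulOp_coeFn w f,
    modOp_coeFn φ f] with x h1 h2 h3 h4
  rw [h1, h2, h3, h4, mul_left_comm]

variable [TopologicalSpace X] [OpensMeasurableSpace X] [OpensMeasurableSpace (X × Y)]

/-- Creation and annihilation act in the `Y` variable only, so a phase depending on `x` passes
through both. -/
theorem createOp_modOp (v : C(Y, ℝ)) (φ : C(X, Circle)) (f : L2 X) :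
    createOp X v (modOp φ f) = modOp (φ.comp ContinuousMap.fst) (createOp X v f) := by
  refine Lp.ext ?_
  filter_upwards [createOp_coeFn v (modOp φ f), createOp_coeFn v f,
    modOp_coeFn (φ.comp ContinuousMap.fst) (createOp X v f), ae_fst (modOp_coeFn φ f)]
    with x h1 h2 h3 h4
  rw [h1, h3, h2, h4, mul_left_comm]
  rfl

theorem annihilateOp_modOp (v : C(Y, ℝ)) (φ : C(X, Circle)) (f : L2 (X × Y)) :
    annihilateOp X v (modOp (φ.comp ContinuousMap.fst) f) = modOp φ (annihilateOp X v f) := by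
  refine Lp.ext ?_
  filter_upwards [annihilateOp_coeFn v (modOp (φ.comp ContinuousMap.fst) f),
    annihilateOp_coeFn v f, modOp_coeFn φ (annihilateOp X v f),
    ae_ae_slice (modOp_coeFn (φ.comp ContinuousMap.fst) f)] with x h1 h2 h3 h4
  rw [h1, h3, h2, ← integral_const_mul]
  refine integral_congr_ae ?_
  filter_upwards [h4] with s hs
  rw [hs, mul_left_comm]
  rfl

/-- Moves the phase into the variable that `partialOpSnd` integrates out. -/
theorem swapOp_modOp_fst [OpensMeasurableSpace (Y × Y)] (φ : C(Y, Circle)) (f : L2 (Y × Y)) :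
    swapOp Y (modOp (φ.comp ContinuousMap.fst) f) =
      modOp (φ.comp ContinuousMap.snd) (swapOp Y f) := by
  refine Lp.ext ?_
  filter_upwards [swapOp_coeFn (modOp (φ.comp ContinuousMap.fst) f), swapOp_coeFn f,
    modOp_coeFn (φ.comp ContinuousMap.snd) (swapOp Y f),
    (Measure.measurePreserving_swap (μ := (volume : Measure Y))
      (ν := (volume : Measure Y))).quasiMeasurePreserving.ae
        (modOp_coeFn (φ.comp ContinuousMap.fst) f)] with x h1 h2 h3 h4
  rw [h1, h3, h2, h4]
  rfl

/-- Modulations in the integration variable whose integrals against square-integrable functions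
vanish in the limit make the annihilation operator tend strongly to zero. -/
theorem tendsto_annihilateOp_modOp (v : C(Y, ℝ)) (φ : ℕ → C(Y, Circle))
    (hφ : ∀ h : Y → ℂ, MemLp h 2 (volume : Measure Y) →
      Tendsto (fun n => ∫ s, (φ n s : ℂ) * h s) atTop (𝓝 0)) (f : L2 (X × Y)) :
    Tendsto (fun n => annihilateOp X v (modOp ((φ n).comp ContinuousMap.snd) f))
      atTop (𝓝 0) := by
  set g : ℕ → L2 X := fun n => annihilateOp X v (modOp ((φ n).comp ContinuousMap.snd) f) with hg
  have hgx : ∀ᵐ x ∂(volume : Measure X), ∀ n,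
      g n x = ∫ s, (φ n s : ℂ) * ((v s : ℂ) * f (x, s)) := by
    refine ae_all_iff.2 fun n => ?_
    filter_upwards [annihilateOp_coeFn v (modOp ((φ n).comp ContinuousMap.snd) f),
      ae_ae_slice (modOp_coeFn ((φ n).comp ContinuousMap.snd) f)] with x h1 h2
    rw [hg, h1]
    refine integral_congr_ae ?_
    filter_upwards [h2] with s hs
    rw [hs, mul_left_comm]
    rfl
  -- The dominating function is `∫ |v(s)| |f(x, s)| ds`: phases have modulus one, so it bounds every
  -- `g n`, and it is itself an annihilation, hence square-integrable.
  have hG := memLp_annihilate (⟨fun y => |v y|, by fun_prop⟩ : C(Y, ℝ))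
    ((Lp.memLp f).norm.ofReal (K := ℂ))
  have hG2 := (memLp_two_iff_integrable_sq_norm hG.1).1 hG
  have hbound : ∀ n, ∀ᵐ x ∂(volume : Measure X), ‖‖g n x‖ ^ 2‖ ≤
      ‖∫ s, ((|v s| : ℝ) : ℂ) * ((‖f (x, s)‖ : ℝ) : ℂ)‖ ^ 2 := by
    intro n
    filter_upwards [hgx] with x hx
    rw [norm_pow, norm_norm, hx n]
    gcongr
    refine (norm_integral_le_integral_norm _).trans (le_of_eq ?_)
    simp_rw [← Complex.ofReal_mul]
    rw [integral_complex_ofReal, Complex.norm_real, Real.norm_of_nonneg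
      (integral_nonneg fun s => by positivity)]
    simp [Circle.norm_coe]
  -- Almost every slice is square-integrable, so `hφ` yields convergence at almost every `x`.
  have hslice : ∀ᵐ x ∂(volume : Measure X), MemLp (fun s => (v s : ℂ) * f (x, s)) 2 := by
    have h1 : AEStronglyMeasurable f ((volume : Measure X).prod (volume : Measure Y)) :=
      Lp.aestronglyMeasurable f
    have h2 : Integrable (fun z => ‖f z‖ ^ 2)
        ((volume : Measure X).prod (volume : Measure Y)) :=
      (memLp_two_iff_integrable_sq_norm (Lp.aestronglyMeasurable f)).1 (Lp.memLp f)
    filter_upwards [h1.prodMk_left, h2.prod_right_ae] with x h3 h4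
    exact memLp_mul v ((memLp_two_iff_integrable_sq_norm h3).2 h4)
  have hlim : ∀ᵐ x ∂(volume : Measure X), Tendsto (fun n => ‖g n x‖ ^ 2) atTop (𝓝 0) := by
    filter_upwards [hgx, hslice] with x hx hs
    simp_rw [hx]
    simpa using (hφ _ hs).norm.pow 2
  have hI := tendsto_integral_of_dominated_convergence _
    (fun n => (Lp.aestronglyMeasurable (g n)).norm.pow 2) hG2 hbound hlim
  rw [integral_zero] at hI
  have hN : ∀ n, ∫ x, ‖g n x‖ ^ 2 = ‖g n‖ ^ 2 := by
    intro n
    have h := L2.inner_def (𝕜 := ℂ) (g n) (g n)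
    simp_rw [inner_self_eq_norm_sq_to_K] at h
    norm_cast at h
    rw [h]
  rw [tendsto_zero_iff_norm_tendsto_zero]
  have := (hI.congr hN).sqrt
  simpa [Real.sqrt_sq] using this

end Integral

/-! ### A Riemann–Lebesgue lemma on the torus -/

/-- The character `p ↦ exp (i n pⱼ)` of the torus. -/
def character {ν : ℕ} (j : Fin ν) (n : ℤ) : C(Torus ν, Circle) :=
  ⟨fun p => AddCircle.toCircle (n • p j), AddCircle.continuous_toCircle.comp (by fun_prop)⟩

/-- Translating coordinate `j` by `π / n` changes the sign of the integrand and preserves the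
measure. -/
theorem integral_character_eq_zero {ν : ℕ} (j : Fin ν) {n : ℤ} (hn : n ≠ 0) :
    ∫ p, (character j n p : ℂ) = 0 := by
  refine integral_eq_zero_of_add_right_eq_neg (μ := volume)
    (g := Pi.single j ((2 * Real.pi / 2 / n : ℝ) : AddCircle (2 * Real.pi))) fun p => ?_
  have := fourier_add_half_inv_index hn Real.two_pi_pos (p j)
  simpa [character, fourier_apply] using this

theorem conj_character_mul_character {ν : ℕ} (j : Fin ν) (m n : ℤ) (p : Torus ν) :
    (starRingEnd ℂ) (character j m p : ℂ) * (character j n p : ℂ) =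
      (character j (n - m) p : ℂ) := by
  rw [← Circle.coe_inv_eq_conj, ← Circle.coe_mul]
  simp only [character, ContinuousMap.coe_mk, AddCircle.toCircle_zsmul, zpow_sub]
  rw [mul_comm]

theorem conj_character {ν : ℕ} (j : Fin ν) (n : ℤ) (p : Torus ν) :
    (starRingEnd ℂ) (character j n p : ℂ) = (character j (-n) p : ℂ) := by
  simp [character]

/-- The index is `-n` because the inner product conjugates its first argument: pairing with `h` then
integrates `h` against the character of index `n`. -/
theorem exists_orthonormal_character {ν : ℕ} (j : Fin ν) :
    ∃ c : ℂ, c ≠ 0 ∧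
      Orthonormal ℂ (fun n : ℕ => modOp (character j (-(n : ℤ))) (Lp.const 2 volume c)) := by
  have hV : volume.real (Set.univ : Set (Torus ν)) ≠ 0 := by
    rw [measureReal_def, ENNReal.toReal_ne_zero]
    exact ⟨(isOpen_univ.measure_pos volume Set.univ_nonempty).ne', measure_ne_top _ _⟩
  have hV' : (0 : ℝ) < volume.real (Set.univ : Set (Torus ν)) :=
    lt_of_le_of_ne measureReal_nonneg hV.symm
  -- The constant is `vol^(-1/2)`, which makes the constant function a unit vector.
  refine ⟨((volume.real (Set.univ : Set (Torus ν)) ^ (1 / (2 : ℝ)))⁻¹ : ℝ), ?_, ?_, ?_⟩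
  · exact_mod_cast (inv_pos.2 (Real.rpow_pos_of_pos hV' _)).ne'
  · intro n
    rw [LinearIsometry.norm_map,
      Lp.norm_const' 2 volume _ two_ne_zero ENNReal.ofNat_ne_top, Complex.norm_real,
      Real.norm_of_nonneg (by positivity), ENNReal.toReal_ofNat]
    exact inv_mul_cancel₀ (Real.rpow_pos_of_pos hV' _).ne'
  · intro m n hmn
    generalize (((volume.real (Set.univ : Set (Torus ν)) ^ (1 / (2 : ℝ)))⁻¹ : ℝ) : ℂ) = c
    change ⟪modOp (character j (-(m : ℤ))) (Lp.const 2 volume c),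
      modOp (character j (-(n : ℤ))) (Lp.const 2 volume c)⟫_ℂ = 0
    have hne : -(n : ℤ) - -(m : ℤ) ≠ 0 := by omega
    rw [L2.inner_def, ← mul_zero ((starRingEnd ℂ) c * c), ← integral_character_eq_zero j hne,
      ← integral_const_mul]
    refine integral_congr_ae ?_
    filter_upwards [modOp_coeFn (character j (-(m : ℤ))) (Lp.const 2 volume c),
      modOp_coeFn (character j (-(n : ℤ))) (Lp.const 2 volume c),
      Lp.coeFn_const 2 (volume : Measure (Torus ν)) c] with p h1 h2 h3
    rw [h1, h2, h3, ← conj_character_mul_character, RCLike.inner_apply, map_mul]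
    simp only [Function.const_apply]
    ring

/-- By Bessel's inequality the coefficients of `h` are square-summable, hence tend to zero; the
normalising constant is then divided out. -/
theorem tendsto_integral_character_mul {ν : ℕ} (j : Fin ν) {h : Torus ν → ℂ}
    (hh : MemLp h 2 (volume : Measure (Torus ν))) :
    Tendsto (fun n : ℕ => ∫ p, (character j n p : ℂ) * h p) atTop (𝓝 0) := by
  obtain ⟨c, hc, ho⟩ := exists_orthonormal_character j
  have h1 := (ho.inner_products_summable (x := hh.toLp h)).tendsto_atTop_zero.sqrt
  simp only [Real.sqrt_sq (norm_nonneg _), Real.sqrt_zero] at h1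
  rw [← tendsto_zero_iff_norm_tendsto_zero] at h1
  have h2 := h1.const_mul ((starRingEnd ℂ) c)⁻¹
  rw [mul_zero] at h2
  refine h2.congr fun n => ?_
  rw [L2.inner_def, ← integral_const_mul]
  refine integral_congr_ae ?_
  filter_upwards [modOp_coeFn (character j (-(n : ℤ))) (Lp.const 2 volume c),
    Lp.coeFn_const 2 (volume : Measure (Torus ν)) c, hh.coeFn_toLp] with p h3 h4 h5
  rw [h3, h4, h5, RCLike.inner_apply, map_mul, conj_character, neg_neg]
  have : (starRingEnd ℂ) c ≠ 0 := by simpa using hc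
  simp only [Function.const_apply]
  field_simp

/-! ### Modulation of the channel operators -/

/-- The isometry `(x, y) ↦ (U x, V y)` of the Hilbert direct sum. -/
def prodIsometry {E F : Type} [NormedAddCommGroup E] [NormedSpace ℂ E] [NormedAddCommGroup F]
    [NormedSpace ℂ F] (U : E →ₗᵢ[ℂ] E) (V : F →ₗᵢ[ℂ] F) :
    WithLp 2 (E × F) →ₗᵢ[ℂ] WithLp 2 (E × F) where
  toLinearMap := (blockOp2 U.toContinuousLinearMap 0 0 V.toContinuousLinearMap).toLinearMap
  norm_map' x := by
    rw [← sq_eq_sq₀ (norm_nonneg _) (norm_nonneg _), WithLp.prod_norm_sq_eq_of_L2,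
      WithLp.prod_norm_sq_eq_of_L2]
    simp [blockOp2]

theorem blockOp2_prodIsometry {E F : Type} [NormedAddCommGroup E] [NormedSpace ℂ E]
    [NormedAddCommGroup F] [NormedSpace ℂ F] {U : E →ₗᵢ[ℂ] E} {V : F →ₗᵢ[ℂ] F}
    {A : E →L[ℂ] E} {B : F →L[ℂ] E} {C : E →L[ℂ] F} {D : F →L[ℂ] F}
    (hA : ∀ x, A (U x) = U (A x)) (hB : ∀ y, B (V y) = U (B y))
    (hC : ∀ x, C (U x) = V (C x)) (hD : ∀ y, D (V y) = V (D y)) (z : WithLp 2 (E × F)) :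
    blockOp2 A B C D (prodIsometry U V z) = prodIsometry U V (blockOp2 A B C D z) := by
  refine (WithLp.equiv 2 (E × F)).injective (Prod.ext ?_ ?_) <;>
  simp [blockOp2, prodIsometry, hA, hB, hC, hD]

/-- After the swap the annihilation factor already tends strongly to zero, and the fixed bounded
operators to its left preserve this. -/
theorem tendsto_partialOpFst_modOp {ν : ℕ} (j : Fin ν) (v : C(Torus ν, ℝ))
    (f : L2 (Torus2 ν)) :
    Tendsto (fun n : ℕ => partialOpFst v (modOp ((character j n).comp ContinuousMap.fst) f))
      atTop (𝓝 0) := by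
  have h := tendsto_annihilateOp_modOp v (fun n : ℕ => character j n)
    (fun _ => tendsto_integral_character_mul j) (swapOp (Torus ν) f)
  have h2 := ((swapOp (Torus ν)).continuous.comp
    (createOp (Torus ν) v).continuous).tendsto 0 |>.comp h
  simpa [partialOpFst, partialOpSnd, swapOp_modOp_fst, Function.comp_def] using h2

theorem isSelfAdjoint_channelH3 {ν : ℕ} (w₂ : C(Torus2 ν, ℝ)) (w₃ : C(Torus3 ν, ℝ))
    (v₃ : C(Torus ν, ℝ)) : IsSelfAdjoint (channelH3 w₂ w₃ v₃) :=
  isSelfAdjoint_blockOp2 (inner_mulOp_left w₂) (inner_annihilateOp_left v₃) (inner_mulOp_left w₃)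

theorem channelH3_sub_channelH1 {ν : ℕ} (w₂ : C(Torus2 ν, ℝ)) (w₃ : C(Torus3 ν, ℝ))
    (v₂₁ v₃ : C(Torus ν, ℝ)) :
    channelH3 w₂ w₃ v₃ - channelH1 w₂ w₃ v₂₁ v₃ = blockOp2 (partialOpFst v₂₁) 0 0 0 := by
  refine ContinuousLinearMap.ext fun z => (WithLp.equiv 2 _).injective (Prod.ext ?_ ?_) <;>
  simp [channelH3, channelH1, blockOp2]

/-- For `ν ≥ 1` already the spectrum of `H₁` contains the spectrum of `H₃`. -/
theorem spectrum_channelH3_subset_spectrum_channelH1 {ν : ℕ} (hν : 1 ≤ ν)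
    (w₂ : C(Torus2 ν, ℝ)) (w₃ : C(Torus3 ν, ℝ)) (v₂₁ v₃ : C(Torus ν, ℝ)) :
    spectrum ℂ (channelH3 w₂ w₃ v₃) ⊆ spectrum ℂ (channelH1 w₂ w₃ v₂₁ v₃) := by
  -- The phase depends on `p` alone; `1 ≤ ν` provides the coordinate it oscillates in.
  let φ : ℕ → C(Torus2 ν, Circle) := fun n =>
    (character (⟨0, hν⟩ : Fin ν) n).comp ContinuousMap.fst
  refine spectrum_subset_of_asymptotically_invisible (isSelfAdjoint_channelH3 w₂ w₃ v₃)
    (fun n => prodIsometry (modOp (φ n)) (modOp ((φ n).comp ContinuousMap.fst)))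
    (fun n f => blockOp2_prodIsometry (mulOp_modOp _ _) (annihilateOp_modOp _ _)
      (createOp_modOp _ _) (mulOp_modOp _ _) f) fun f => ?_
  -- `H₃ - H₁` sees only the two-particle component, so the limit is taken there and embedded with
  -- zero second entry.
  have h := tendsto_partialOpFst_modOp (⟨0, hν⟩ : Fin ν) v₂₁ f.fst
  have h2 := ((WithLp.prodContinuousLinearEquiv 2 ℂ
    (L2 (Torus2 ν)) (L2 (Torus3 ν))).symm.continuous.comp
    (Continuous.prodMk_left (0 : L2 (Torus3 ν)))).tendsto 0 |>.comp h
  rw [channelH3_sub_channelH1]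
  simp only [Function.comp_def] at h2
  have h0 : (WithLp.prodContinuousLinearEquiv 2 ℂ (L2 (Torus2 ν)) (L2 (Torus3 ν))).symm
      ((0 : L2 (Torus2 ν)), (0 : L2 (Torus3 ν))) = 0 := map_zero _
  rw [h0] at h2
  refine h2.congr fun n => ?_
  simp [blockOp2, prodIsometry, φ]

end FockModel

end

theorem corollary3p1 (ν : ℕ) (hν : 1 ≤ ν)
    (w₁ : C(FockModel.Torus ν, ℝ)) (w₂ : C(FockModel.Torus2 ν, ℝ))
    (w₃ : C(FockModel.Torus3 ν, ℝ))
    (v₂ v₃ v₂₁ v₂₂ : C(FockModel.Torus ν, ℝ)) :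
    spectrum ℂ (FockModel.channelH3 w₂ w₃ v₃) ⊆
      spectrum ℂ (FockModel.channelH1 w₂ w₃ v₂₁ v₃) ∪
        spectrum ℂ (FockModel.channelH2 w₁ w₂ w₃ v₂ v₂₂ v₃) :=
  (FockModel.spectrum_channelH3_subset_spectrum_channelH1 hν w₂ w₃ v₂₁ v₃).trans
    Set.subset_union_left
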